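/- **Setting.** Consider $n$ qubits and a connectivity graph $G$ on them. A circuit of depth $s$ is a sequence of $s$ layers; each layer consists of unitary gates with pairwise disjoint supports, each gate acting on one qubit or on two qubits adjacent in $G$. The light cone of a qubit $i$ under a circuit is the set obtained from $\{i\}$ by going through the layers in order and adjoining at each layer the supports of all its gates that meet the current set. A function $f:\mathbb N\to\mathbb N$ is a light-cone function for $G$ if, for every $s$, the light cone of every qubit under every circuit of depth at most $s$ has at most $f(s)$ elements (for instance the exact maximum, or $f(s)=2^s$ for all-to-all connectivity, or $f(s)=(2s+1)^D$ for nearest neighbours in a $D$-dimensional grid). For a pure state $|\psi\rangle$ and $\delta\in\mathbb R$, the $\delta$-approximate circuit complexity $\mathscr C^\delta(|\psi\rangle)$ is the least depth of a circuit $U$ with $\big\||\psi'\rangle\langle\psi'|-|\psi\rangle\langle\psi|\big\|_1\le\delta$, where $|\psi'\rangle=U|0^n\rangle$ and $\|A\|_1=\operatorname{tr}\sqrt{A^\dagger A}$ (it is $\infty$ if there is no such circuit). An $(\!(n,k)\!)$ code is a subspace $C\subseteq(\mathbb C^2)^{\otimes n}$ of dimension $2^k$; its code states are the unit vectors of $C$.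 Let $\Gamma=\Pi_C/2^k$, where $\Pi_C$ is the orthogonal projection onto $C$. For $d\in\mathbb N$ the subsystem variance is $$\varepsilon(d)=\max_{|\psi\rangle\in C,\ \|\psi\|=1}\ \max_{|R|\le d}\ \big\|\psi_R-\Gamma_R\big\|_1 ,$$ where $R$ ranges over sets of at most $d$ qubits and the subscript $R$ denotes the reduced operator on $R$ (partial trace over the complement of $R$). **Theorem.** Let $f$ be a light-cone function for $G$, let $C$ be an $(\!(n,k)\!)$ code, let $|\psi_1\rangle,|\psi_2\rangle$ be two orthogonal code states, and let $t\in\mathbb N$ and $\delta\in\mathbb R$ be such that $\mathscr C^\delta(|\psi_1\rangle)\le t$ and $\mathscr C^\delta(|\psi_2\rangle)\le t$. If $$\delta\le\Big(1-\frac1{f(4t)}\Big)^{n/2},$$ then $$\varepsilon(f(t))>\frac{1}{e\,f(4t)}-\delta .$$ -/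

import Mathlib

noncomputable section

namespace SRECode

/-- Computational basis labels of a register of qubits indexed by `ι`. -/
abbrev Bits (ι : Type*) := ι → Fin 2

/-- The Hilbert space of `n` qubits. -/
abbrev Qubits (n : ℕ) := EuclideanSpace ℂ (Bits (Fin n))

/-- Operators on a register of qubits, as matrices in the computational basis. -/
abbrev Op (ι : Type*) := Matrix (Bits ι) (Bits ι) ℂ

/-- The operator `B ⊗ 1` on `n` qubits, where `B` acts on the qubits in `S`
and the identity acts on the others. -/
def extend {n : ℕ} (S : Finset (Fin n)) (B : Op S) : Op (Fin n) :=
  Matrix.of fun x y =>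
    if ∀ i, i ∉ S → x i = y i then B (fun i => x i) (fun i => y i) else 0

/-- The bit string that is `a` on `R` and `c` outside `R`. -/
def glue {n : ℕ} (R : Finset (Fin n)) (a : Bits R) (c : Bits {i // i ∉ R}) : Bits (Fin n) :=
  fun i => if h : i ∈ R then a ⟨i, h⟩ else c ⟨i, h⟩

/-- The partial trace over the complement of `R`: the reduced operator on `R`. -/
def reduced {n : ℕ} (R : Finset (Fin n)) (ρ : Op (Fin n)) : Op R :=
  Matrix.of fun a b => ∑ c : Bits {i // i ∉ R}, ρ (glue R a c) (glue R b c)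

/-- The trace norm (Schatten 1-norm) `‖A‖₁ = tr √(A† A)`, the sum of the singular values;
there is no factor `1/2`. -/
def traceNorm {m : Type*} [Fintype m] [DecidableEq m] (A : Matrix m m ℂ) : ℝ :=
  ∑ i, √((Matrix.isHermitian_conjTranspose_mul_self A).eigenvalues i)

/-- The operator `|ψ⟩⟨ψ|`. -/
def pureState {n : ℕ} (ψ : Qubits n) : Op (Fin n) :=
  Matrix.of fun x y => ψ x * star (ψ y)

/-- The maximally mixed state `Π / dim C` of a code subspace `C`, where `Π` is the orthogonal
projection onto `C`. -/
def maxMixed {n : ℕ} (C : Submodule ℂ (Qubits n)) : Op (Fin n) :=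
  ((Module.finrank ℂ C : ℂ)⁻¹) • (Matrix.toEuclideanCLM (𝕜 := ℂ)).symm C.starProjection

/-- The subsystem variance `ε(d)` of a code: the maximum of `‖ψ_R - Γ_R‖₁` over all code states
`ψ` and all sets `R` of at most `d` qubits, `Γ` being the maximally mixed code state. -/
def subsystemVariance {n : ℕ} (C : Submodule ℂ (Qubits n)) (d : ℕ) : ℝ :=
  sSup {x : ℝ | ∃ ψ ∈ C, ‖ψ‖ = 1 ∧ ∃ R : Finset (Fin n), R.card ≤ d ∧
    x = traceNorm (reduced R (pureState ψ) - reduced R (maxMixed C))}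

/-- A unitary gate on one qubit, or on two qubits joined by an edge of the connectivity graph. -/
structure Gate {n : ℕ} (G : SimpleGraph (Fin n)) where
  supp : Finset (Fin n)
  allowed : (∃ i, supp = {i}) ∨ ∃ i j, G.Adj i j ∧ supp = {i, j}
  unitary : Matrix.unitaryGroup (Bits supp) ℂ

/-- A layer: gates acting in parallel on pairwise disjoint sets of qubits. -/
structure Layer {n : ℕ} (G : SimpleGraph (Fin n)) where
  gates : List (Gate G)
  disjoint : gates.Pairwise fun g h => Disjoint g.supp h.supp

/-- The unitary of a layer. (The factors commute.) -/
def Layer.toOp {n : ℕ} {G : SimpleGraph (Fin n)} (L : Layer G) : Op (Fin n) :=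
  (L.gates.map fun g => extend g.supp (g.unitary : Op g.supp)).prod

/-- A circuit is a list of layers, the head being applied first. Its depth is its length. -/
abbrev Circuit {n : ℕ} (G : SimpleGraph (Fin n)) := List (Layer G)

/-- The unitary `U = L_t ⋯ L_1` of a circuit with layers `L_1, …, L_t`. -/
def circuitOp {n : ℕ} {G : SimpleGraph (Fin n)} (c : Circuit G) : Op (Fin n) :=
  c.foldl (fun U L => L.toOp * U) 1

/-- The state `U |0ⁿ⟩` prepared by a circuit. -/
def prepared {n : ℕ} {G : SimpleGraph (Fin n)} (c : Circuit G) : Qubits n :=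
  Matrix.toEuclideanCLM (𝕜 := ℂ) (circuitOp c) (EuclideanSpace.single (fun _ => 0) 1)

/-- The `δ`-approximate circuit complexity of `ψ`: the least depth of a circuit that prepares,
from `|0ⁿ⟩`, a state within trace-norm distance `δ` of `ψ` (infinite if there is none). -/
def approxComplexity {n : ℕ} (G : SimpleGraph (Fin n)) (δ : ℝ) (ψ : Qubits n) : ℕ∞ :=
  ⨅ (c : Circuit G) (_ : traceNorm (pureState (prepared c) - pureState ψ) ≤ δ), (c.length : ℕ∞)

open Classical in
/-- One step of light-cone growth: adjoin to `S` the supports of all gates of the layer that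
meet `S`. -/
def Layer.grow {n : ℕ} {G : SimpleGraph (Fin n)} (L : Layer G) (S : Finset (Fin n)) :
    Finset (Fin n) :=
  Finset.univ.filter fun j => j ∈ S ∨ ∃ g ∈ L.gates, j ∈ g.supp ∧ ¬ Disjoint g.supp S

/-- The light cone of a set of qubits under a circuit. It depends only on the circuit structure,
not on the unitaries. -/
def lightcone {n : ℕ} {G : SimpleGraph (Fin n)} (c : Circuit G) (S : Finset (Fin n)) :
    Finset (Fin n) :=
  c.foldl (fun T L => L.grow T) S

/-- The largest size of the light cone of a single qubit under a circuit of depth at most `t`. -/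
def lightconeSize {n : ℕ} (G : SimpleGraph (Fin n)) (t : ℕ) : ℕ :=
  sSup {m : ℕ | ∃ (c : Circuit G) (i : Fin n), c.length ≤ t ∧ m = (lightcone c {i}).card}

/-- `f` is a light-cone function for the connectivity graph `G`: the light cone of a qubit under
a circuit of depth at most `t` has at most `f t` elements. Examples are `lightconeSize G` itself,
`2 ^ t` for every `G`, and `(2 * t + 1) ^ D` for nearest neighbours in a `D`-dimensional grid. -/
def IsLightconeFunction {n : ℕ} (G : SimpleGraph (Fin n)) (f : ℕ → ℕ) : Prop :=
  ∀ t, lightconeSize G t ≤ f t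

end SRECode

end

/-!
Let `φ₁ = U₁ |0ⁿ⟩` and `φ₂ = U₂ |0ⁿ⟩` be prepared by circuits of depth at most `t`, within `δ` of the
orthogonal code states `ψ₁` and `ψ₂`. The overlap `|⟨φ₂, φ₁⟩|` is estimated in two ways.

On the one hand, the trace distance of pure states is the sine of their angle, so that the overlap
is at most `δ` by orthogonality of `ψ₁` and `ψ₂` (`norm_inner_le_of_traceNorm_le`).

On the other hand, `|⟨φ₂, φ₁⟩|²` is the probability that measuring all qubits of `U₁ᴴ U₂ |0ⁿ⟩` gives
only zeros. Qubit `i` is found in the state `1` with the probability that `φ₂` fails the check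
`U₁ |1⟩⟨1|ᵢ U₁ᴴ`. The check is supported on a light cone of at most `f t` qubits and satisfied
by `φ₁`; as `φ₁` and `φ₂` look alike on so few qubits, this probability is at most `ε (f t) + δ`
(`SupportedOn.norm_trace_proj_le_of_near_code`). The product state `|0ⁿ⟩` has no correlations, so
outcomes are independent for sets of qubits whose light cones under `U₂ᴴ U₁` are disjoint
(`zeroProb_insert_of_disjoint`), and a qubit has at most `f (4 * t)` neighbours, itself included.
If `ε (f t) + δ ≤ 1 / (e D)` with `D = f (4 * t)`, then the Lovász local lemma
(`lovasz_local_lemma`) with parameter `1 / (D + 1)` gives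
`|⟨φ₂, φ₁⟩|² ≥ (1 - 1 / (D + 1)) ^ n > (1 - 1 / D) ^ n ≥ δ²`, a contradiction.
-/

namespace SRECode
open Matrix

/-! ### The trace norm -/

section TraceNorm

variable {m : Type*} [Fintype m] [DecidableEq m]

theorem exists_unitary_conj_gram_eq_diagonal (X : Matrix m m ℂ) :
    ∃ V ∈ unitaryGroup m ℂ, Vᴴ * (Xᴴ * X) * V =
      diagonal fun i => (((isHermitian_conjTranspose_mul_self X).eigenvalues i : ℝ) : ℂ) := by
  refine ⟨_, (isHermitian_conjTranspose_mul_self X).eigenvectorUnitary.2, ?_⟩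
  have h := (isHermitian_conjTranspose_mul_self X).conjStarAlgAut_star_eigenvectorUnitary
  rw [Unitary.conjStarAlgAut_star_apply] at h
  exact h

/-- One half of the duality between the trace norm and the operator norm. -/
theorem norm_trace_mul_le_traceNorm {Q : Matrix m m ℂ} (hQ : Q ∈ unitaryGroup m ℂ)
    (X : Matrix m m ℂ) : ‖(Q * X).trace‖ ≤ traceNorm X := by
  obtain ⟨V, hV, hd⟩ := exists_unitary_conj_gram_eq_diagonal X
  have hVV : V * Vᴴ = 1 := mem_unitaryGroup_iff.1 hV
  have hVV' : Vᴴ * V = 1 := mem_unitaryGroup_iff'.1 hV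
  have hQQ : Q * Qᴴ = 1 := mem_unitaryGroup_iff.1 hQ
  -- In the eigenbasis of `Xᴴ * X`, the columns of `X` have norms `√(λ i)`.
  have h1 : (Q * X).trace = ((Vᴴ * Q) * (X * V)).trace := by
    rw [Matrix.trace_mul_comm (Vᴴ * Q), Matrix.mul_assoc X, ← Matrix.mul_assoc V, hVV,
      Matrix.one_mul, Matrix.trace_mul_comm]
  have hZ : (Vᴴ * Q) * (Vᴴ * Q)ᴴ = 1 := by
    rw [conjTranspose_mul, conjTranspose_conjTranspose, Matrix.mul_assoc, ← Matrix.mul_assoc Q,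
      hQQ, Matrix.one_mul, hVV']
  have hY : (X * V)ᴴ * (X * V) = diagonal fun i =>
      (((isHermitian_conjTranspose_mul_self X).eigenvalues i : ℝ) : ℂ) := by
    rw [← hd, conjTranspose_mul]; simp only [Matrix.mul_assoc]
  rw [h1]
  generalize Vᴴ * Q = Z at hZ ⊢
  generalize X * V = Y at hY ⊢
  refine (norm_sum_le _ _).trans (Finset.sum_le_sum fun i _ => ?_)
  have hz : ∑ j, ‖Z i j‖ ^ 2 = 1 := by
    have := congrFun (congrFun hZ i) i
    simp only [Matrix.mul_apply, conjTranspose_apply, one_apply_eq] at this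
    have h2 : (((∑ j, ‖Z i j‖ ^ 2 : ℝ)) : ℂ) = 1 := by
      rw [← this]; push_cast
      exact Finset.sum_congr rfl fun j _ => (Complex.mul_conj' _).symm
    exact_mod_cast h2
  have hy : ∑ j, ‖Y j i‖ ^ 2 = (isHermitian_conjTranspose_mul_self X).eigenvalues i := by
    have := congrFun (congrFun hY i) i
    simp only [Matrix.mul_apply, conjTranspose_apply, diagonal_apply_eq] at this
    have h2 : (((∑ j, ‖Y j i‖ ^ 2 : ℝ)) : ℂ) =
        ((isHermitian_conjTranspose_mul_self X).eigenvalues i : ℝ) := by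
      rw [← this]; push_cast
      exact Finset.sum_congr rfl fun j _ => (Complex.conj_mul' _).symm
    exact_mod_cast h2
  calc ‖(Z * Y).diag i‖ ≤ ∑ j, ‖Z i j‖ * ‖Y j i‖ := by
        rw [diag_apply, Matrix.mul_apply]
        exact (norm_sum_le _ _).trans_eq (by simp)
    _ ≤ √(∑ j, ‖Z i j‖ ^ 2) * √(∑ j, ‖Y j i‖ ^ 2) := Real.sum_mul_le_sqrt_mul_sqrt _ _ _
    _ = _ := by rw [hz, hy]; simp

/-- Changing the expectation of a projection requires twice as much trace norm: apply
`norm_trace_mul_le_traceNorm` to the reflection `2 * P - 1`. -/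
theorem norm_trace_proj_mul_le {P X : Matrix m m ℂ} (hP : P.IsHermitian) (hPP : P * P = P)
    (hX : X.trace = 0) : ‖(P * X).trace‖ ≤ traceNorm X / 2 := by
  have hQ : (2 : ℂ) • P - 1 ∈ unitaryGroup m ℂ := by
    rw [mem_unitaryGroup_iff, star_eq_conjTranspose, conjTranspose_sub, conjTranspose_smul, hP.eq]
    simp only [Matrix.sub_mul, Matrix.mul_sub, smul_mul_smul_comm, hPP]
    ext i j
    simp
    ring
  have h := norm_trace_mul_le_traceNorm hQ X
  rw [Matrix.sub_mul, Matrix.smul_mul, trace_sub, trace_smul, Matrix.one_mul, hX, sub_zero,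
    norm_smul] at h
  simp at h
  linarith

theorem traceNorm_nonneg (X : Matrix m m ℂ) : 0 ≤ traceNorm X :=
  Finset.sum_nonneg fun _ _ => Real.sqrt_nonneg _

omit [DecidableEq m] in
theorem trace_gram (X : Matrix m m ℂ) :
    (Xᴴ * X).trace = ((∑ i, ∑ j, ‖X j i‖ ^ 2 : ℝ) : ℂ) := by
  simp only [trace, diag_apply, Matrix.mul_apply, conjTranspose_apply]
  push_cast
  exact Finset.sum_congr rfl fun i _ => Finset.sum_congr rfl fun j _ => Complex.conj_mul' _

theorem sum_eigenvalues_gram (X : Matrix m m ℂ) :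
    ∑ i, (isHermitian_conjTranspose_mul_self X).eigenvalues i = ∑ i, ∑ j, ‖X j i‖ ^ 2 := by
  have h := (isHermitian_conjTranspose_mul_self X).trace_eq_sum_eigenvalues
  rw [trace_gram] at h
  apply Complex.ofReal_injective
  rw [h]
  push_cast
  rfl

open scoped ComplexOrder in
theorem eigenvalues_gram_nonneg (X : Matrix m m ℂ) (i : m) :
    0 ≤ (isHermitian_conjTranspose_mul_self X).eigenvalues i :=
  (posSemidef_conjTranspose_mul_self X).eigenvalues_nonneg i

theorem traceNorm_le_card_add_sum (X : Matrix m m ℂ) :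
    traceNorm X ≤ Fintype.card m + ∑ i, ∑ j, ‖X j i‖ ^ 2 := by
  rw [← sum_eigenvalues_gram, traceNorm, Fintype.card_eq_sum_ones, Nat.cast_sum,
    ← Finset.sum_add_distrib]
  refine Finset.sum_le_sum fun i _ => ?_
  have h0 := eigenvalues_gram_nonneg X i
  have := Real.sq_sqrt h0
  push_cast
  nlinarith [Real.sqrt_nonneg ((isHermitian_conjTranspose_mul_self X).eigenvalues i),
    sq_nonneg (√((isHermitian_conjTranspose_mul_self X).eigenvalues i) - 1)]

/-- If all nonzero singular values of `X` are equal to `s`, then `s * ‖X‖₁ = ‖X‖₂²`. -/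
theorem mul_traceNorm_eq_of_gram_mul_gram {X : Matrix m m ℂ} {s : ℝ} (hs : 0 ≤ s)
    (h : (Xᴴ * X) * (Xᴴ * X) = ((s ^ 2 : ℝ) : ℂ) • (Xᴴ * X)) :
    s * traceNorm X = ∑ i, ∑ j, ‖X j i‖ ^ 2 := by
  obtain ⟨V, hV, hd⟩ := exists_unitary_conj_gram_eq_diagonal X
  have hVV : V * Vᴴ = 1 := mem_unitaryGroup_iff.1 hV
  rw [← sum_eigenvalues_gram, traceNorm, Finset.mul_sum]
  refine Finset.sum_congr rfl fun i _ => ?_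
  have h0 := eigenvalues_gram_nonneg X i
  have h1 : (Vᴴ * (Xᴴ * X) * V) * (Vᴴ * (Xᴴ * X) * V) =
      ((s ^ 2 : ℝ) : ℂ) • (Vᴴ * (Xᴴ * X) * V) := by
    calc _ = Vᴴ * ((Xᴴ * X) * (V * Vᴴ) * (Xᴴ * X)) * V := by simp only [Matrix.mul_assoc]
      _ = _ := by rw [hVV, Matrix.mul_one, h, Matrix.mul_smul, Matrix.smul_mul]
  rw [hd, diagonal_mul_diagonal] at h1
  have h2 := congrFun (congrFun h1 i) i
  rw [diagonal_apply_eq, Matrix.smul_apply, diagonal_apply_eq, smul_eq_mul] at h2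
  have h3 : (isHermitian_conjTranspose_mul_self X).eigenvalues i *
      (isHermitian_conjTranspose_mul_self X).eigenvalues i =
      s ^ 2 * (isHermitian_conjTranspose_mul_self X).eigenvalues i := by exact_mod_cast h2
  rcases eq_or_ne ((isHermitian_conjTranspose_mul_self X).eigenvalues i) 0 with h4 | h4
  · rw [h4]; simp
  · rw [mul_right_cancel₀ h4 h3, Real.sqrt_sq hs, sq]

end TraceNorm

/-! ### Pure states -/

section PureStates

variable {n : ℕ}

theorem pureState_eq_vecMulVec (ψ : Qubits n) :
    pureState ψ = vecMulVec ψ.ofLp (star ψ.ofLp) := rfl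

theorem trace_mul_pureState (A : Op (Fin n)) (ψ : Qubits n) :
    (A * pureState ψ).trace = star ψ.ofLp ⬝ᵥ (A *ᵥ ψ.ofLp) := by
  rw [pureState_eq_vecMulVec, mul_vecMulVec, trace_vecMulVec, dotProduct_comm]

theorem trace_pureState {ψ : Qubits n} (h : ‖ψ‖ = 1) : (pureState ψ).trace = 1 := by
  have := trace_mul_pureState 1 ψ
  rw [Matrix.one_mul, Matrix.one_mulVec, dotProduct_comm,
    ← EuclideanSpace.inner_eq_star_dotProduct] at this
  rw [this, inner_self_eq_norm_sq_to_K, h]; simp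

theorem isHermitian_pureState (ψ : Qubits n) : (pureState ψ).IsHermitian := by
  ext x y; simp [pureState, mul_comm]

theorem pureState_mul_pureState (φ ψ : Qubits n) :
    pureState φ * pureState ψ = inner ℂ φ ψ • vecMulVec φ.ofLp (star ψ.ofLp) := by
  rw [pureState_eq_vecMulVec, pureState_eq_vecMulVec, vecMulVec_mul_vecMulVec,
    EuclideanSpace.inner_eq_star_dotProduct, dotProduct_comm, vecMulVec_smul]

theorem pureState_mul_self {ψ : Qubits n} (h : ‖ψ‖ = 1) :
    pureState ψ * pureState ψ = pureState ψ := by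
  rw [pureState_mul_pureState, inner_self_eq_norm_sq_to_K, h, pureState_eq_vecMulVec]; simp

theorem pureState_mul_pureState_mul_pureState (φ ψ : Qubits n) :
    pureState φ * pureState ψ * pureState φ =
      ((‖(inner ℂ φ ψ : ℂ)‖ ^ 2 : ℝ) : ℂ) • pureState φ := by
  rw [pureState_mul_pureState, pureState_eq_vecMulVec, Matrix.smul_mul, vecMulVec_mul_vecMulVec,
    dotProduct_comm, ← EuclideanSpace.inner_eq_star_dotProduct, vecMulVec_smul, smul_smul,
    ← inner_conj_symm ψ φ, Complex.mul_conj']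
  push_cast; rfl

theorem trace_pureState_mul_pureState (φ ψ : Qubits n) :
    (pureState φ * pureState ψ).trace = ((‖(inner ℂ φ ψ : ℂ)‖ ^ 2 : ℝ) : ℂ) := by
  rw [pureState_mul_pureState, trace_smul, trace_vecMulVec,
    ← EuclideanSpace.inner_eq_star_dotProduct, ← inner_conj_symm ψ φ, smul_eq_mul,
    Complex.mul_conj']
  push_cast; rfl

/-- The trace distance of two pure states is the sine of the angle between them: the difference
`X` of the two projections satisfies `X ^ 3 = sin² • X` and `tr (X ^ 2) = 2 * sin²`. -/
theorem one_sub_norm_inner_sq_eq {φ ψ : Qubits n} (hφ : ‖φ‖ = 1) (hψ : ‖ψ‖ = 1) :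
    1 - ‖(inner ℂ φ ψ : ℂ)‖ ^ 2 = (traceNorm (pureState φ - pureState ψ) / 2) ^ 2 := by
  have hle : ‖(inner ℂ φ ψ : ℂ)‖ ≤ 1 := by simpa [hφ, hψ] using norm_inner_le_norm (𝕜 := ℂ) φ ψ
  have hs0 : 0 ≤ 1 - ‖(inner ℂ φ ψ : ℂ)‖ ^ 2 := by
    nlinarith [norm_nonneg (inner ℂ φ ψ : ℂ)]
  have hX : (pureState φ - pureState ψ)ᴴ = pureState φ - pureState ψ :=
    ((isHermitian_pureState φ).sub (isHermitian_pureState ψ)).eq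
  have hp := pureState_mul_self hφ
  have hq := pureState_mul_self hψ
  have hpq := pureState_mul_pureState_mul_pureState φ ψ
  have hqp := pureState_mul_pureState_mul_pureState ψ φ
  have htr := trace_pureState_mul_pureState φ ψ
  have htr' := trace_mul_comm (pureState ψ) (pureState φ)
  rw [norm_inner_symm] at hqp
  generalize hc : ‖(inner ℂ φ ψ : ℂ)‖ ^ 2 = c at *
  have hgram : (pureState φ - pureState ψ) * (pureState φ - pureState ψ) =
      pureState φ + pureState ψ - pureState φ * pureState ψ - pureState ψ * pureState φ := by
    simp only [Matrix.sub_mul, Matrix.mul_sub, hp, hq]; abel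
  have hcube : (pureState φ - pureState ψ) * (pureState φ - pureState ψ) *
      (pureState φ - pureState ψ) = ((√(1 - c) ^ 2 : ℝ) : ℂ) • (pureState φ - pureState ψ) := by
    rw [hgram, Real.sq_sqrt hs0]
    simp only [Matrix.sub_mul, Matrix.mul_sub, Matrix.add_mul, hp, hq, hpq, hqp]
    rw [Matrix.mul_assoc (pureState φ), Matrix.mul_assoc (pureState ψ), hp, hq]
    push_cast
    simp only [sub_smul, smul_sub, one_smul]
    abel
  have h4 := mul_traceNorm_eq_of_gram_mul_gram (X := pureState φ - pureState ψ)
    (Real.sqrt_nonneg (1 - c)) (by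
      rw [hX, ← Matrix.mul_assoc, hcube, Matrix.smul_mul])
  have h5 : ∑ i, ∑ j, ‖(pureState φ - pureState ψ) j i‖ ^ 2 = 2 * (1 - c) := by
    apply Complex.ofReal_injective
    rw [← trace_gram, hX, hgram, trace_sub, trace_sub, trace_add, htr', htr, trace_pureState hφ,
      trace_pureState hψ]
    push_cast; ring
  rw [h5] at h4
  rcases eq_or_lt_of_le hs0 with h0 | h0
  · -- If the states agree up to a phase, then `X` itself vanishes.
    have hz : pureState φ - pureState ψ = 0 := by
      rw [← h0, mul_zero] at h5
      ext j i
      have h6 := (Finset.sum_eq_zero_iff_of_nonneg fun i _ =>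
        Finset.sum_nonneg fun j _ => sq_nonneg _).1 h5 i (Finset.mem_univ i)
      have h7 := (Finset.sum_eq_zero_iff_of_nonneg fun j _ => sq_nonneg _).1 h6 j
        (Finset.mem_univ j)
      simpa using h7
    have h8 : traceNorm (pureState φ - pureState ψ) = 0 := by
      rw [hz, traceNorm]
      refine Finset.sum_eq_zero fun i _ => ?_
      have h9 := sum_eigenvalues_gram (0 : Op (Fin n))
      simp only [Matrix.zero_apply, norm_zero, ne_eq, OfNat.ofNat_ne_zero, not_false_eq_true,
        zero_pow, Finset.sum_const_zero] at h9
      rw [(Finset.sum_eq_zero_iff_of_nonneg fun i _ => eigenvalues_gram_nonneg _ i).1 h9 i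
        (Finset.mem_univ i), Real.sqrt_zero]
    rw [← h0, h8]; norm_num
  · have h6 : √(1 - c) ≠ 0 := (Real.sqrt_pos.2 h0).ne'
    have h7 : traceNorm (pureState φ - pureState ψ) = 2 * √(1 - c) := by
      apply mul_left_cancel₀ h6
      rw [h4]
      nlinarith [Real.sq_sqrt hs0]
    rw [h7, mul_div_cancel_left₀ _ two_ne_zero, Real.sq_sqrt hs0]

/-- States close to two orthogonal states are nearly orthogonal. With `s` and `s'` the sines of the
angles of `φ` to `ψ` and of `φ'` to `ψ'`, the bound is `sin (θ + θ') ≤ s + s'`. -/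
theorem norm_inner_le_of_traceNorm_le {φ φ' ψ ψ' : Qubits n} (hφ : ‖φ‖ = 1) (hφ' : ‖φ'‖ = 1)
    (hψ : ‖ψ‖ = 1) (hψ' : ‖ψ'‖ = 1) (horth : inner ℂ ψ ψ' = 0) {δ : ℝ}
    (h : traceNorm (pureState φ - pureState ψ) ≤ δ)
    (h' : traceNorm (pureState φ' - pureState ψ') ≤ δ) : ‖(inner ℂ φ φ' : ℂ)‖ ≤ δ := by
  have key : ∀ {φ ψ : Qubits n}, ‖φ‖ = 1 → ‖ψ‖ = 1 →
      traceNorm (pureState φ - pureState ψ) ≤ δ → ‖φ - (inner ℂ ψ φ : ℂ) • ψ‖ ≤ δ / 2 := by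
    intro φ ψ hφ hψ h
    have h1 := one_sub_norm_inner_sq_eq hφ hψ
    have h2 : ‖φ - (inner ℂ ψ φ : ℂ) • ψ‖ ^ 2 = 1 - ‖(inner ℂ φ ψ : ℂ)‖ ^ 2 := by
      rw [norm_sub_sq (𝕜 := ℂ), inner_smul_right, norm_smul, hφ, hψ, ← inner_conj_symm φ ψ,
        Complex.mul_conj', RCLike.norm_conj]
      rw [← Complex.ofReal_pow, RCLike.re_eq_complex_re, Complex.ofReal_re]
      ring
    have h3 := traceNorm_nonneg (pureState φ - pureState ψ)
    rw [h1] at h2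
    rw [(pow_left_inj₀ (norm_nonneg _) (by positivity) two_ne_zero).1 h2]
    linarith
  have k := key hφ hψ h
  have k' := key hφ' hψ' h'
  have hle : ‖(inner ℂ ψ φ : ℂ)‖ ≤ 1 := by simpa [hφ, hψ] using norm_inner_le_norm (𝕜 := ℂ) ψ φ
  have h1 : (inner ℂ φ φ' : ℂ) = inner ℂ (φ - (inner ℂ ψ φ : ℂ) • ψ) φ' +
      inner ℂ ((inner ℂ ψ φ : ℂ) • ψ) (φ' - (inner ℂ ψ' φ' : ℂ) • ψ') := by
    rw [inner_sub_left, inner_sub_right, inner_smul_right _ ψ', inner_smul_left ψ ψ', horth]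
    ring
  calc ‖(inner ℂ φ φ' : ℂ)‖ = ‖_ + _‖ := congrArg _ h1
    _ ≤ δ / 2 * 1 + 1 * (δ / 2) := by
      refine (norm_add_le _ _).trans ?_
      refine add_le_add ?_ ?_
      · exact (norm_inner_le_norm _ _).trans (by rw [hφ', mul_one, mul_one]; exact k)
      · refine (norm_inner_le_norm _ _).trans ?_
        rw [norm_smul, hψ, mul_one]
        exact mul_le_mul hle k' (norm_nonneg _) zero_le_one
    _ = δ := by ring

end PureStates

/-! ### Operators supported on a set of qubits -/

section Supports

variable {n : ℕ}

/-- The operator `A` acts as the identity outside `S`: its matrix entries vanish unless the two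
bit strings agree off `S`, and do not depend on their common values off `S`. -/
def SupportedOn (S : Finset (Fin n)) (A : Op (Fin n)) : Prop :=
  (∀ x y, (∃ i, i ∉ S ∧ x i ≠ y i) → A x y = 0) ∧
  ∀ x y x' y', (∀ i, i ∉ S → x i = y i) → (∀ i, i ∉ S → x' i = y' i) →
    (∀ i ∈ S, x i = x' i) → (∀ i ∈ S, y i = y' i) → A x y = A x' y'

theorem SupportedOn.mono {S T : Finset (Fin n)} {A : Op (Fin n)} (hA : SupportedOn S A)
    (h : S ⊆ T) : SupportedOn T A := by
  refine ⟨fun x y ⟨i, hi, hxy⟩ => hA.1 x y ⟨i, fun hS => hi (h hS), hxy⟩, ?_⟩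
  intro x y x' y' hxy hxy' hx hy
  by_cases hex : ∃ i, i ∉ S ∧ x i ≠ y i
  · obtain ⟨i, hi, hne⟩ := hex
    rw [hA.1 x y ⟨i, hi, hne⟩, hA.1 x' y']
    have hT : i ∈ T := by by_contra hT; exact hne (hxy i hT)
    exact ⟨i, hi, by rwa [← hx i hT, ← hy i hT]⟩
  · push Not at hex
    refine hA.2 x y x' y' hex (fun i hi => ?_) (fun i hi => hx i (h hi)) fun i hi => hy i (h hi)
    by_cases hT : i ∈ T
    · rw [← hx i hT, ← hy i hT, hex i hi]
    · exact hxy' i hT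

theorem SupportedOn.conjTranspose {S : Finset (Fin n)} {A : Op (Fin n)} (hA : SupportedOn S A) :
    SupportedOn S Aᴴ := by
  refine ⟨fun x y ⟨i, hi, h⟩ => ?_, fun x y x' y' h h' hx hy => ?_⟩
  · rw [conjTranspose_apply, hA.1 y x ⟨i, hi, h.symm⟩, star_zero]
  · rw [conjTranspose_apply, conjTranspose_apply,
      hA.2 y x y' x' (fun i hi => (h i hi).symm) (fun i hi => (h' i hi).symm) hy hx]

/-- For operators with disjoint supports, the sum in the matrix product has a single term. -/
theorem SupportedOn.mul_apply_of_disjoint {S T : Finset (Fin n)} {A B : Op (Fin n)}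
    (hA : SupportedOn S A) (hB : SupportedOn T B) (hST : Disjoint S T) (x y : Bits (Fin n)) :
    (A * B) x y = A x (S.piecewise y x) * B (S.piecewise y x) y := by
  rw [Matrix.mul_apply]
  refine Finset.sum_eq_single _ (fun z _ hz => ?_) fun h => absurd (Finset.mem_univ _) h
  obtain ⟨i, hi⟩ := Function.ne_iff.1 hz
  by_cases hS : i ∈ S
  · rw [Finset.piecewise_eq_of_mem _ _ _ hS] at hi
    rw [hB.1 z y ⟨i, Finset.disjoint_left.1 hST hS, hi⟩, mul_zero]
  · rw [Finset.piecewise_eq_of_notMem _ _ _ hS] at hi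
    rw [hA.1 x z ⟨i, hS, hi.symm⟩, zero_mul]

/-- A product state has no correlations between disjoint sets of qubits. -/
theorem SupportedOn.mul_apply_self_of_disjoint {S T : Finset (Fin n)} {A B : Op (Fin n)}
    (hA : SupportedOn S A) (hB : SupportedOn T B) (hST : Disjoint S T) (x : Bits (Fin n)) :
    (A * B) x x = A x x * B x x := by
  rw [hA.mul_apply_of_disjoint hB hST, Finset.piecewise_same]

theorem SupportedOn.commute {S T : Finset (Fin n)} {A B : Op (Fin n)}
    (hA : SupportedOn S A) (hB : SupportedOn T B) (hST : Disjoint S T) : A * B = B * A := by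
  ext x y
  rw [hA.mul_apply_of_disjoint hB hST, hB.mul_apply_of_disjoint hA hST.symm]
  by_cases h : ∀ i, i ∉ S → i ∉ T → x i = y i
  · have hT : ∀ i, i ∈ T → i ∉ S := fun i hi => Finset.disjoint_right.1 hST hi
    rw [mul_comm (B x _)]
    congr 1
    · refine hA.2 _ _ _ _ ?_ ?_ ?_ ?_ <;> intro i hi <;> by_cases hT' : i ∈ T <;>
        simp_all [Finset.piecewise]
    · refine hB.2 _ _ _ _ ?_ ?_ ?_ ?_ <;> intro i hi <;> by_cases hS' : i ∈ S <;>
        simp_all [Finset.piecewise]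
  · push Not at h
    obtain ⟨i, hS, hT, hxy⟩ := h
    rw [hB.1 _ y ⟨i, hT, by rwa [Finset.piecewise_eq_of_notMem _ _ _ hS]⟩,
      hA.1 _ y ⟨i, hS, by rwa [Finset.piecewise_eq_of_notMem _ _ _ hT]⟩, mul_zero, mul_zero]

theorem supportedOn_diagonal {S : Finset (Fin n)} {d : Bits (Fin n) → ℂ}
    (hd : ∀ x y, (∀ i ∈ S, x i = y i) → d x = d y) : SupportedOn S (diagonal d) := by
  refine ⟨fun x y ⟨i, _, h⟩ => diagonal_apply_ne _ fun hxy => h (congrFun hxy i), ?_⟩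
  intro x y x' y' h h' hx hy
  by_cases hxy : x = y
  · subst hxy
    have : x' = y' := by
      funext i
      by_cases hi : i ∈ S
      · rw [← hx i hi, hy i hi]
      · exact h' i hi
    subst this
    rw [diagonal_apply_eq, diagonal_apply_eq, hd x x' hx]
  · rw [diagonal_apply_ne _ hxy, diagonal_apply_ne]
    rintro rfl
    refine hxy (funext fun i => ?_)
    by_cases hi : i ∈ S
    · rw [hx i hi, hy i hi]
    · exact h i hi

theorem supportedOn_extend (S : Finset (Fin n)) (B : Op S) : SupportedOn S (extend S B) := by
  refine ⟨fun x y ⟨i, hi, h⟩ => ?_, fun x y x' y' h h' hx hy => ?_⟩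
  · rw [extend, of_apply, if_neg fun hxy => h (hxy i hi)]
  · rw [extend, of_apply, of_apply, if_pos h, if_pos h']
    congr 1 <;> funext i
    · exact hx i i.2
    · exact hy i i.2

theorem SupportedOn.exists_eq_extend {S : Finset (Fin n)} {A : Op (Fin n)}
    (hA : SupportedOn S A) : ∃ B, A = extend S B := by
  refine ⟨of fun a b => A (glue S a 0) (glue S b 0), ?_⟩
  ext x y
  rw [extend, of_apply]
  split_ifs with h
  · rw [of_apply]
    refine hA.2 _ _ _ _ h (fun i hi => ?_) (fun i hi => ?_) fun i hi => ?_ <;> simp [glue, hi]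
  · push Not at h
    exact hA.1 x y h

/-- A bit string is the same as a pair of bit strings, on `S` and on its complement. -/
def bitsEquiv (S : Finset (Fin n)) : Bits (Fin n) ≃ Bits S × Bits {i // i ∉ S} :=
  Equiv.piEquivPiSubtypeProd (· ∈ S) fun _ => Fin 2

theorem bitsEquiv_symm_apply (S : Finset (Fin n)) (a : Bits S) (c : Bits {i // i ∉ S}) :
    (bitsEquiv S).symm (a, c) = glue S a c := rfl

theorem extend_glue (S : Finset (Fin n)) (B : Op S) (a b : Bits S) (c c' : Bits {i // i ∉ S}) :
    extend S B (glue S a c) (glue S b c') = if c = c' then B a b else 0 := by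
  have : (∀ i, i ∉ S → glue S a c i = glue S b c' i) ↔ c = c' := by
    refine ⟨fun h => funext fun ⟨i, hi⟩ => by simpa [glue, hi] using h i hi, ?_⟩
    rintro rfl i hi
    simp [glue, hi]
  rw [extend, of_apply]
  simp only [this]
  congr 2 <;> funext i <;> simp [glue, i.2]

theorem sum_bits_eq_sum_glue {M : Type*} [AddCommMonoid M] (S : Finset (Fin n))
    (F : Bits (Fin n) → M) : ∑ x, F x = ∑ a : Bits S, ∑ c, F (glue S a c) := by
  rw [← Fintype.sum_prod_type', ← (bitsEquiv S).symm.sum_comp]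
  rfl

theorem extend_mul (S : Finset (Fin n)) (B B' : Op S) :
    extend S (B * B') = extend S B * extend S B' := by
  ext x y
  obtain ⟨⟨a, c⟩, rfl⟩ := (bitsEquiv S).symm.surjective x
  obtain ⟨⟨b, c'⟩, rfl⟩ := (bitsEquiv S).symm.surjective y
  simp only [bitsEquiv_symm_apply]
  rw [extend_glue, Matrix.mul_apply, Matrix.mul_apply, sum_bits_eq_sum_glue S]
  simp only [extend_glue]
  by_cases h : c = c' <;> simp [h]

theorem extend_conjTranspose (S : Finset (Fin n)) (B : Op S) :
    extend S Bᴴ = (extend S B)ᴴ := by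
  ext x y
  obtain ⟨⟨a, c⟩, rfl⟩ := (bitsEquiv S).symm.surjective x
  obtain ⟨⟨b, c'⟩, rfl⟩ := (bitsEquiv S).symm.surjective y
  simp only [bitsEquiv_symm_apply]
  rw [conjTranspose_apply, extend_glue, extend_glue]
  simp only [eq_comm (a := c'), conjTranspose_apply]
  split_ifs <;> simp

theorem extend_one (S : Finset (Fin n)) : extend S (1 : Op S) = 1 := by
  ext x y
  obtain ⟨⟨a, c⟩, rfl⟩ := (bitsEquiv S).symm.surjective x
  obtain ⟨⟨b, c'⟩, rfl⟩ := (bitsEquiv S).symm.surjective y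
  simp only [one_apply, (bitsEquiv S).symm.apply_eq_iff_eq, Prod.mk.injEq]
  rw [bitsEquiv_symm_apply, bitsEquiv_symm_apply, extend_glue]
  simp only [one_apply]
  split_ifs <;> simp_all

theorem extend_injective (S : Finset (Fin n)) : Function.Injective (extend S) := by
  intro B B' h
  ext a b
  simpa [extend_glue] using congrFun (congrFun h (glue S a 0)) (glue S b 0)

theorem trace_extend_mul (S : Finset (Fin n)) (B : Op S) (ρ : Op (Fin n)) :
    (extend S B * ρ).trace = (B * reduced S ρ).trace := by
  simp only [trace, diag_apply, Matrix.mul_apply]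
  rw [sum_bits_eq_sum_glue S]
  refine Finset.sum_congr rfl fun a _ => ?_
  simp only [sum_bits_eq_sum_glue S, extend_glue, reduced, of_apply, ite_mul, zero_mul,
    Finset.sum_ite_eq, Finset.mem_univ, if_true, Finset.mul_sum]
  exact Finset.sum_comm

theorem reduced_sub (S : Finset (Fin n)) (ρ σ : Op (Fin n)) :
    reduced S (ρ - σ) = reduced S ρ - reduced S σ := by
  ext a b; simp [reduced]

theorem trace_reduced (S : Finset (Fin n)) (ρ : Op (Fin n)) :
    (reduced S ρ).trace = ρ.trace := by
  rw [← Matrix.one_mul (reduced S ρ), ← trace_extend_mul, extend_one, Matrix.one_mul]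

theorem SupportedOn.mul {S : Finset (Fin n)} {A B : Op (Fin n)} (hA : SupportedOn S A)
    (hB : SupportedOn S B) : SupportedOn S (A * B) := by
  obtain ⟨A, rfl⟩ := hA.exists_eq_extend
  obtain ⟨B, rfl⟩ := hB.exists_eq_extend
  rw [← extend_mul]
  exact supportedOn_extend _ _

/-- A projection supported on `S` distinguishes two states of equal trace only as well as their
reductions to `S` do. -/
theorem SupportedOn.norm_trace_proj_mul_sub_le {S : Finset (Fin n)} {P : Op (Fin n)}
    (hS : SupportedOn S P) (hP : P.IsHermitian) (hPP : P * P = P) {ρ σ : Op (Fin n)}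
    (h : ρ.trace = σ.trace) :
    ‖(P * (ρ - σ)).trace‖ ≤ traceNorm (reduced S ρ - reduced S σ) / 2 := by
  obtain ⟨B, rfl⟩ := hS.exists_eq_extend
  rw [trace_extend_mul, ← reduced_sub]
  refine norm_trace_proj_mul_le (extend_injective S ?_) (extend_injective S ?_) ?_
  · rw [extend_conjTranspose, hP.eq]
  · rw [extend_mul, hPP]
  · rw [trace_reduced, trace_sub, h, sub_self]

end Supports

/-! ### Light cones and inverse circuits -/

section LightCones

variable {n : ℕ} {G : SimpleGraph (Fin n)}

theorem gate_mul_conjTranspose (g : Gate G) :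
    extend g.supp (g.unitary : Op g.supp) * (extend g.supp (g.unitary : Op g.supp))ᴴ = 1 := by
  rw [← extend_conjTranspose, ← extend_mul, ← star_eq_conjTranspose,
    mem_unitaryGroup_iff.1 g.unitary.2, extend_one]

theorem Layer.toOp_mem (L : Layer G) : L.toOp ∈ unitaryGroup (Bits (Fin n)) ℂ := by
  refine Submonoid.list_prod_mem _ fun A hA => ?_
  obtain ⟨g, _, rfl⟩ := List.mem_map.1 hA
  exact mem_unitaryGroup_iff.2 (gate_mul_conjTranspose g)

theorem circuitOp_cons (L : Layer G) (c : Circuit G) :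
    circuitOp (L :: c) = circuitOp c * L.toOp := by
  have aux : ∀ (c : Circuit G) (U : Op (Fin n)),
      c.foldl (fun U L => L.toOp * U) U = circuitOp c * U := by
    intro c
    induction c with
    | nil => intro U; simp [circuitOp]
    | cons L c ih =>
      intro U
      rw [circuitOp, List.foldl_cons, List.foldl_cons, ih, ih, Matrix.mul_one, Matrix.mul_assoc]
  rw [circuitOp, List.foldl_cons, aux, Matrix.mul_one]

theorem circuitOp_append (c c' : Circuit G) :
    circuitOp (c ++ c') = circuitOp c' * circuitOp c := by
  induction c with
  | nil => simp [circuitOp]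
  | cons L c ih => rw [List.cons_append, circuitOp_cons, circuitOp_cons, ih, Matrix.mul_assoc]

theorem circuitOp_mem (c : Circuit G) : circuitOp c ∈ unitaryGroup (Bits (Fin n)) ℂ := by
  induction c with
  | nil => exact one_mem _
  | cons L c ih => rw [circuitOp_cons]; exact mul_mem ih L.toOp_mem

theorem Layer.mem_grow {L : Layer G} {S : Finset (Fin n)} {j : Fin n} :
    j ∈ L.grow S ↔ j ∈ S ∨ ∃ g ∈ L.gates, j ∈ g.supp ∧ ¬ Disjoint g.supp S := by
  simp [Layer.grow]

theorem Layer.grow_mono (L : Layer G) {S T : Finset (Fin n)} (h : S ⊆ T) :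
    L.grow S ⊆ L.grow T := by
  intro j hj
  rw [Layer.mem_grow] at hj ⊢
  rcases hj with hj | ⟨g, hg, hj, hd⟩
  · exact Or.inl (h hj)
  · exact Or.inr ⟨g, hg, hj, fun hd' => hd (hd'.mono_right h)⟩

theorem Layer.grow_singleton_symm (L : Layer G) {i j : Fin n} (h : j ∈ L.grow {i}) :
    i ∈ L.grow {j} := by
  simp only [Layer.mem_grow, Finset.mem_singleton, Finset.disjoint_singleton_right,
    not_not] at h ⊢
  rcases h with rfl | ⟨g, hg, hj, hi⟩
  · exact Or.inl rfl
  · exact Or.inr ⟨g, hg, hi, hj⟩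

theorem Layer.exists_mem_grow_singleton {L : Layer G} {S : Finset (Fin n)} {j : Fin n}
    (h : j ∈ L.grow S) : ∃ i ∈ S, j ∈ L.grow {i} := by
  rw [Layer.mem_grow] at h
  rcases h with h | ⟨g, hg, hj, hd⟩
  · exact ⟨j, h, Layer.mem_grow.2 (Or.inl (Finset.mem_singleton_self j))⟩
  · obtain ⟨i, hi, hS⟩ := Finset.not_disjoint_iff.1 hd
    exact ⟨i, hS, Layer.mem_grow.2 (Or.inr ⟨g, hg, hj, by simpa using hi⟩)⟩

theorem lightcone_cons (L : Layer G) (c : Circuit G) (S : Finset (Fin n)) :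
    lightcone (L :: c) S = lightcone c (L.grow S) := rfl

theorem lightcone_append (c c' : Circuit G) (S : Finset (Fin n)) :
    lightcone (c ++ c') S = lightcone c' (lightcone c S) := List.foldl_append

theorem lightcone_mono (c : Circuit G) {S T : Finset (Fin n)} (h : S ⊆ T) :
    lightcone c S ⊆ lightcone c T := by
  induction c generalizing S T with
  | nil => exact h
  | cons L c ih => exact ih (L.grow_mono h)

theorem subset_lightcone (c : Circuit G) (S : Finset (Fin n)) : S ⊆ lightcone c S := by
  induction c generalizing S with
  | nil => exact subset_rfl
  | cons L c ih =>
    exact subset_trans (fun j hj => Layer.mem_grow.2 (Or.inl hj)) (ih (L.grow S))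

theorem exists_mem_lightcone_singleton {c : Circuit G} {S : Finset (Fin n)} {j : Fin n}
    (h : j ∈ lightcone c S) : ∃ i ∈ S, j ∈ lightcone c {i} := by
  induction c generalizing S with
  | nil => exact ⟨j, h, Finset.mem_singleton_self j⟩
  | cons L c ih =>
    obtain ⟨i, hi, hj⟩ := ih h
    obtain ⟨k, hk, hi⟩ := Layer.exists_mem_grow_singleton hi
    exact ⟨k, hk, lightcone_mono c (Finset.singleton_subset_iff.2 hi) hj⟩

/-- Conjugation by one layer spreads the support only along the gates that meet it: the other gates
commute with the operator and cancel. -/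
theorem SupportedOn.layer_conj {S : Finset (Fin n)} {A : Op (Fin n)} (hA : SupportedOn S A)
    (L : Layer G) : SupportedOn (L.grow S) (L.toOp * A * L.toOpᴴ) := by
  classical
  obtain ⟨gs, hgs⟩ := L
  have key : SupportedOn (Finset.univ.filter fun j =>
      j ∈ S ∨ ∃ g ∈ gs, j ∈ g.supp ∧ ¬ Disjoint g.supp S)
      ((gs.map fun g => extend g.supp (g.unitary : Op g.supp)).prod * A *
        (gs.map fun g => extend g.supp (g.unitary : Op g.supp)).prodᴴ) := by
    induction gs with
    | nil => simpa using hA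
    | cons g gs ih =>
      obtain ⟨hg, hgs⟩ := List.pairwise_cons.1 hgs
      have ih := ih hgs
      rw [List.map_cons, List.prod_cons, conjTranspose_mul]
      have e : ∀ E P : Op (Fin n), E * P * A * (Pᴴ * Eᴴ) = E * (P * A * Pᴴ) * Eᴴ := fun E P => by
        simp only [Matrix.mul_assoc]
      rw [e]
      have hE := supportedOn_extend g.supp (g.unitary : Op g.supp)
      have hmono : (Finset.univ.filter fun j =>
          j ∈ S ∨ ∃ g ∈ gs, j ∈ g.supp ∧ ¬ Disjoint g.supp S) ⊆ Finset.univ.filter fun j =>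
          j ∈ S ∨ ∃ h ∈ g :: gs, j ∈ h.supp ∧ ¬ Disjoint h.supp S := by
        intro j
        simp only [Finset.mem_filter, Finset.mem_univ, true_and, List.mem_cons]
        rintro (h | ⟨g', hg', h⟩)
        · exact Or.inl h
        · exact Or.inr ⟨g', Or.inr hg', h⟩
      by_cases hd : Disjoint g.supp S
      · have hd' : Disjoint g.supp (Finset.univ.filter fun j =>
            j ∈ S ∨ ∃ g ∈ gs, j ∈ g.supp ∧ ¬ Disjoint g.supp S) := by
          rw [Finset.disjoint_left]
          intro j hj hj'
          simp only [Finset.mem_filter, Finset.mem_univ, true_and] at hj'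
          rcases hj' with h | ⟨g', hg', h, _⟩
          · exact Finset.disjoint_left.1 hd hj h
          · exact Finset.disjoint_left.1 (hg g' hg') hj h
        rw [hE.commute ih hd', Matrix.mul_assoc, gate_mul_conjTranspose, Matrix.mul_one]
        exact ih.mono hmono
      · have hsub : g.supp ⊆ Finset.univ.filter fun j =>
            j ∈ S ∨ ∃ h ∈ g :: gs, j ∈ h.supp ∧ ¬ Disjoint h.supp S := by
          intro j hj
          simp only [Finset.mem_filter, Finset.mem_univ, true_and, List.mem_cons]
          exact Or.inr ⟨g, Or.inl rfl, hj, hd⟩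
        exact ((hE.mono hsub).mul (ih.mono hmono)).mul (hE.mono hsub).conjTranspose
  have hgrow : Layer.grow ⟨gs, hgs⟩ S = Finset.univ.filter fun j =>
      j ∈ S ∨ ∃ g ∈ gs, j ∈ g.supp ∧ ¬ Disjoint g.supp S := by
    ext j; simp [Layer.mem_grow]
  rw [hgrow]
  exact key

theorem SupportedOn.circuit_conj {S : Finset (Fin n)} {A : Op (Fin n)} (hA : SupportedOn S A)
    (c : Circuit G) : SupportedOn (lightcone c S) (circuitOp c * A * (circuitOp c)ᴴ) := by
  induction c generalizing S A with
  | nil => simpa [circuitOp, lightcone] using hA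
  | cons L c ih =>
    have := ih (hA.layer_conj L)
    rw [circuitOp_cons, lightcone_cons, conjTranspose_mul]
    simpa only [Matrix.mul_assoc] using this

/-- The inverse gate. -/
def Gate.inv (g : Gate G) : Gate G := ⟨g.supp, g.allowed, g.unitary⁻¹⟩

/-- The inverse of a layer: the inverse gates in the opposite order. -/
def Layer.inv (L : Layer G) : Layer G where
  gates := (L.gates.map Gate.inv).reverse
  disjoint := by
    rw [List.pairwise_reverse, List.pairwise_map]
    exact L.disjoint.imp fun h => h.symm

/-- The inverse circuit. -/
def inverse (c : Circuit G) : Circuit G := (c.map Layer.inv).reverse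

theorem length_inverse (c : Circuit G) : (inverse c).length = c.length := by simp [inverse]

theorem inverse_cons (L : Layer G) (c : Circuit G) : inverse (L :: c) = inverse c ++ [L.inv] := by
  simp [inverse]

theorem Layer.inv_toOp (L : Layer G) : L.inv.toOp = L.toOpᴴ := by
  rw [Layer.toOp, Layer.toOp, conjTranspose_list_prod, Layer.inv, List.map_reverse, List.map_map,
    List.map_map]
  congr 2
  refine List.map_congr_left fun g _ => ?_
  exact extend_conjTranspose _ _

theorem circuitOp_inverse (c : Circuit G) : circuitOp (inverse c) = (circuitOp c)ᴴ := by
  induction c with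
  | nil => simp [inverse, circuitOp]
  | cons L c ih =>
    rw [inverse_cons, circuitOp_append, circuitOp_cons, circuitOp_cons, ih, L.inv_toOp,
      conjTranspose_mul]
    simp [circuitOp]

theorem Layer.inv_grow (L : Layer G) (S : Finset (Fin n)) : L.inv.grow S = L.grow S := by
  ext j
  simp [Layer.mem_grow, Layer.inv, Gate.inv]

theorem mem_lightcone_inverse {c : Circuit G} {i j : Fin n} (h : j ∈ lightcone c {i}) :
    i ∈ lightcone (inverse c) {j} := by
  induction c generalizing i with
  | nil => simpa [inverse, lightcone, eq_comm] using h
  | cons L c ih =>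
    obtain ⟨k, hk, hj⟩ := exists_mem_lightcone_singleton (c := c) h
    rw [inverse_cons, lightcone_append, lightcone_cons, L.inv_grow]
    exact L.grow_mono (Finset.singleton_subset_iff.2 (ih hj)) (L.grow_singleton_symm hk)

theorem mem_lightcone_append_inverse {c : Circuit G} {i j : Fin n}
    (h : ¬ Disjoint (lightcone c {i}) (lightcone c {j})) :
    j ∈ lightcone (c ++ inverse c) {i} := by
  obtain ⟨k, hi, hj⟩ := Finset.not_disjoint_iff.1 h
  rw [lightcone_append]
  exact lightcone_mono _ (Finset.singleton_subset_iff.2 hi) (mem_lightcone_inverse hj)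

theorem disjoint_lightcone_of_forall {c : Circuit G} {S T : Finset (Fin n)}
    (h : ∀ j ∈ T, Disjoint S (lightcone c {j})) : Disjoint S (lightcone c T) := by
  rw [Finset.disjoint_left]
  intro k hk hT
  obtain ⟨j, hj, hk'⟩ := exists_mem_lightcone_singleton hT
  exact Finset.disjoint_left.1 (h j hj) hk hk'

theorem card_lightcone_le {f : ℕ → ℕ} (hf : IsLightconeFunction G f) {c : Circuit G} {t : ℕ}
    (hc : c.length ≤ t) (i : Fin n) : (lightcone c {i}).card ≤ f t := by
  refine le_trans (b := lightconeSize G t) (le_csSup ⟨n, ?_⟩ ⟨c, i, hc, rfl⟩) (hf t)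
  rintro _ ⟨c', i', _, rfl⟩
  simpa using Finset.card_le_univ (lightcone c' {i'})

end LightCones

/-! ### The Lovász local lemma -/

section LocalLemma

variable {ι : Type*} [DecidableEq ι]

/-- The symmetric Lovász local lemma. The number `m T` is the probability that none of the events
with index in `T` occurs, so that `m T - m (insert i T)` is the probability that the event `i` occurs
and none of those in `T` does; this decreases with `T`. The event `i` is independent of the events
outside `N i`. -/
theorem lovasz_local_lemma {m : Finset ι → ℝ} {N : ι → Finset ι} {D : ℕ} {x : ℝ}
    (hx₀ : 0 ≤ x) (hx₁ : x ≤ 1) (hm₀ : ∀ T, 0 ≤ m T) (hm₁ : m ∅ = 1)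
    (hmono : ∀ i S T, S ⊆ T → m T - m (insert i T) ≤ m S - m (insert i S))
    (hN : ∀ i, i ∈ N i) (hD : ∀ i, (N i).card ≤ D)
    (hind : ∀ i T, Disjoint (N i) T → m (insert i T) = m {i} * m T)
    (hp : ∀ i, 1 - m {i} ≤ x * (1 - x) ^ (D - 1)) (T : Finset ι) :
    (1 - x) ^ T.card ≤ m T := by
  have h1x : 0 ≤ 1 - x := sub_nonneg.2 hx₁
  -- Given that no event of `T` occurs, the event `i` has probability at most `x`.
  have key : ∀ k, ∀ T : Finset ι, T.card = k → ∀ i ∉ T, (1 - x) * m T ≤ m (insert i T) := by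
    intro k
    induction k using Nat.strong_induction_on with
    | _ k ih =>
      intro T hT i hi
      set T₂ := T \ N i with hT₂
      -- Chain rule along the neighbours of `i` in `T`.
      have chain : ∀ S : Finset ι, S ⊆ T ∩ N i → (1 - x) ^ S.card * m T₂ ≤ m (S ∪ T₂) := by
        intro S
        induction S using Finset.induction_on with
        | empty => intro _; simp
        | insert j S hj ihS =>
          intro hS
          have hjT := Finset.mem_inter.1 (hS (Finset.mem_insert_self j S))
          have hS' : S ⊆ T ∩ N i := (Finset.subset_insert j S).trans hS
          have hjn : j ∉ S ∪ T₂ := by simp [hj, hT₂, hjT.2]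
          have hss : S ∪ T₂ ⊂ T := by
            refine (Finset.ssubset_iff_of_subset ?_).2 ⟨j, hjT.1, hjn⟩
            exact Finset.union_subset (hS'.trans Finset.inter_subset_left) Finset.sdiff_subset
          have h1 := ih _ (hT ▸ Finset.card_lt_card hss) (S ∪ T₂) rfl j hjn
          rw [Finset.insert_union, Finset.card_insert_of_notMem hj, pow_succ']
          calc (1 - x) * (1 - x) ^ S.card * m T₂ = (1 - x) * ((1 - x) ^ S.card * m T₂) := by ring
            _ ≤ (1 - x) * m (S ∪ T₂) := mul_le_mul_of_nonneg_left (ihS hS') h1x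
            _ ≤ _ := h1
      have hc := chain (T ∩ N i) subset_rfl
      rw [Finset.union_comm, hT₂, Finset.sdiff_union_inter, ← hT₂] at hc
      have hcard : (T ∩ N i).card ≤ D - 1 := by
        have h1 : T ∩ N i ⊆ (N i).erase i := fun j hj => by
          obtain ⟨hjT, hjN⟩ := Finset.mem_inter.1 hj
          exact Finset.mem_erase.2 ⟨fun h => hi (h ▸ hjT), hjN⟩
        have h2 := Finset.card_le_card h1
        rw [Finset.card_erase_of_mem (hN i)] at h2
        exact h2.trans (Nat.sub_le_sub_right (hD i) 1)
      have h1 := hmono i T₂ T Finset.sdiff_subset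
      rw [hind i T₂ Finset.disjoint_sdiff] at h1
      have h2 : (1 - m {i}) * m T₂ ≤ x * (1 - x) ^ (D - 1) * m T₂ :=
        mul_le_mul_of_nonneg_right (hp i) (hm₀ _)
      have h3 : (1 - x) ^ (D - 1) * m T₂ ≤ (1 - x) ^ (T ∩ N i).card * m T₂ :=
        mul_le_mul_of_nonneg_right (pow_le_pow_of_le_one h1x (by linarith) hcard) (hm₀ _)
      have h4 := mul_le_mul_of_nonneg_left (h3.trans hc) hx₀
      linarith
  induction T using Finset.induction_on with
  | empty => simp [hm₁]
  | insert i T hi ih =>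
    rw [Finset.card_insert_of_notMem hi, pow_succ']
    exact (mul_le_mul_of_nonneg_left ih h1x).trans (key _ T rfl i hi)

/-- The choice `x = 1 / (D + 1)` in the local lemma works since `(1 + 1 / D) ^ D ≤ e`. It is
smaller than the usual `1 / D` and thereby makes the final inequality strict. -/
theorem one_div_exp_mul_le {D : ℕ} (hD : 0 < D) :
    1 / (Real.exp 1 * D) ≤ 1 / ((D : ℝ) + 1) * (1 - 1 / ((D : ℝ) + 1)) ^ (D - 1) := by
  have hD' : (0 : ℝ) < D := by exact_mod_cast hD
  have h1 : ((D : ℝ) + 1) ^ D ≤ Real.exp 1 * (D : ℝ) ^ D := by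
    have h2 : (1 : ℝ) / D + 1 ≤ Real.exp (1 / D) := Real.add_one_le_exp _
    have h3 := pow_le_pow_left₀ (by positivity) h2 D
    rw [← Real.exp_nat_mul, mul_one_div_cancel hD'.ne', div_add_one hD'.ne', div_pow,
      div_le_iff₀ (by positivity), add_comm] at h3
    exact h3
  obtain ⟨d, rfl⟩ : ∃ d, D = d + 1 := ⟨D - 1, by omega⟩
  have h4 : (1 : ℝ) - 1 / (((d + 1 : ℕ) : ℝ) + 1) =
      ((d + 1 : ℕ) : ℝ) / (((d + 1 : ℕ) : ℝ) + 1) := by field_simp; ring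
  rw [h4, Nat.add_sub_cancel, div_pow, div_mul_div_comm, one_mul,
    div_le_div_iff₀ (by positivity) (by positivity), one_mul, ← pow_succ']
  calc _ ≤ Real.exp 1 * ((d + 1 : ℕ) : ℝ) ^ (d + 1) := h1
    _ = _ := by ring

end LocalLemma

/-! ### Measurement outcomes of a shallow circuit -/

section NoErrorProbability

variable {n : ℕ}

/-- The probability that a measurement of the state `Wᴴ |0ⁿ⟩` in the computational basis gives `0`
on all qubits in `T`. -/
noncomputable def zeroProb (W : Op (Fin n)) (T : Finset (Fin n)) : ℝ :=
  ∑ x : Bits (Fin n), if ∀ i ∈ T, x i = 0 then ‖W 0 x‖ ^ 2 else 0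

theorem conj_diagonal_apply (W : Op (Fin n)) (d : Bits (Fin n) → ℂ) :
    (W * diagonal d * Wᴴ) 0 0 = ∑ x, d x * ((‖W 0 x‖ ^ 2 : ℝ) : ℂ) := by
  rw [Matrix.mul_apply]
  refine Finset.sum_congr rfl fun x _ => ?_
  rw [mul_diagonal, conjTranspose_apply]
  push_cast
  rw [← Complex.mul_conj']
  simp only [RCLike.star_def]
  ring

theorem zeroProb_eq (W : Op (Fin n)) (T : Finset (Fin n)) :
    (W * diagonal (fun x : Bits (Fin n) => if ∀ i ∈ T, x i = 0 then (1 : ℂ) else 0) * Wᴴ) 0 0 =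
      zeroProb W T := by
  rw [conj_diagonal_apply, zeroProb]
  push_cast
  exact Finset.sum_congr rfl fun x _ => by split_ifs <;> simp

theorem zeroProb_nonneg (W : Op (Fin n)) (T : Finset (Fin n)) : 0 ≤ zeroProb W T :=
  Finset.sum_nonneg fun x _ => by split_ifs <;> positivity

theorem zeroProb_empty {W : Op (Fin n)} (hW : W ∈ unitaryGroup (Bits (Fin n)) ℂ) :
    zeroProb W ∅ = 1 := by
  have h := zeroProb_eq W ∅
  have h1 : W * Wᴴ = 1 := mem_unitaryGroup_iff.1 hW
  simp only [Finset.notMem_empty, false_implies, implies_true, if_true, diagonal_one,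
    Matrix.mul_one, h1, one_apply_eq] at h
  exact_mod_cast h.symm

theorem zeroProb_univ (W : Op (Fin n)) : zeroProb W Finset.univ = ‖W 0 0‖ ^ 2 := by
  rw [zeroProb, Finset.sum_eq_single (0 : Bits (Fin n))]
  · simp
  · intro x _ hx
    rw [if_neg fun h => hx (funext fun i => h i (Finset.mem_univ i))]
  · simp

theorem zeroProb_sub_insert_le (W : Op (Fin n)) (i : Fin n) {S T : Finset (Fin n)} (h : S ⊆ T) :
    zeroProb W T - zeroProb W (insert i T) ≤ zeroProb W S - zeroProb W (insert i S) := by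
  simp only [zeroProb, ← Finset.sum_sub_distrib]
  refine Finset.sum_le_sum fun x _ => ?_
  have h0 : 0 ≤ ‖W 0 x‖ ^ 2 := by positivity
  have hTS : (∀ j ∈ T, x j = 0) → ∀ j ∈ S, x j = 0 := fun hT j hj => hT j (h hj)
  simp only [Finset.forall_mem_insert]
  split_ifs <;> first | linarith | (exfalso; tauto)

/-- Sets of qubits whose light cones are disjoint have independent measurement outcomes. -/
theorem zeroProb_insert_of_disjoint {G : SimpleGraph (Fin n)} (c : Circuit G) {i : Fin n}
    {T : Finset (Fin n)} (h : Disjoint (lightcone c {i}) (lightcone c T)) :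
    zeroProb (circuitOp c) (insert i T) =
      zeroProb (circuitOp c) {i} * zeroProb (circuitOp c) T := by
  have hd : ∀ S : Finset (Fin n), SupportedOn (lightcone c S) (circuitOp c *
      diagonal (fun x : Bits (Fin n) => if ∀ i ∈ S, x i = 0 then (1 : ℂ) else 0) * (circuitOp c)ᴴ) :=
    fun S =>
    (supportedOn_diagonal fun x y hxy => by
      have : (∀ i ∈ S, x i = 0) ↔ ∀ i ∈ S, y i = 0 :=
        forall₂_congr fun i hi => by rw [hxy i hi]
      simp only [this]).circuit_conj c
  have h1 := (hd {i}).mul_apply_self_of_disjoint (hd T) h 0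
  have hW : (circuitOp c)ᴴ * circuitOp c = 1 := mem_unitaryGroup_iff'.1 (circuitOp_mem c)
  have h2 : ∀ A B : Op (Fin n), (circuitOp c * A * (circuitOp c)ᴴ) *
      (circuitOp c * B * (circuitOp c)ᴴ) = circuitOp c * (A * B) * (circuitOp c)ᴴ := fun A B => by
    calc _ = circuitOp c * A * ((circuitOp c)ᴴ * circuitOp c) * B * (circuitOp c)ᴴ := by
          simp only [Matrix.mul_assoc]
      _ = _ := by rw [hW, Matrix.mul_one]; simp only [Matrix.mul_assoc]
  rw [h2, diagonal_mul_diagonal, zeroProb_eq, zeroProb_eq] at h1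
  have h3 : (fun x : Bits (Fin n) =>
      (if ∀ j ∈ ({i} : Finset (Fin n)), x j = 0 then (1 : ℂ) else 0) *
      (if ∀ j ∈ T, x j = 0 then (1 : ℂ) else 0)) =
      fun x => if ∀ j ∈ insert i T, x j = 0 then (1 : ℂ) else 0 := by
    funext x
    simp only [Finset.forall_mem_insert, Finset.mem_singleton, forall_eq]
    by_cases hi : x i = 0 <;> simp [hi]
  rw [h3, zeroProb_eq] at h1
  exact_mod_cast h1

/-- The local lemma for measurement outcomes. Qubits are dependent only if their light cones meet,
and then one lies in the light cone of the other under the circuit followed by its inverse. -/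
theorem pow_le_zeroProb_univ {G : SimpleGraph (Fin n)} (c : Circuit G) {D : ℕ} (hD : 0 < D)
    (hcard : ∀ i, (lightcone (c ++ inverse c) {i}).card ≤ D)
    (hp : ∀ i, 1 - zeroProb (circuitOp c) {i} ≤ 1 / (Real.exp 1 * D)) :
    (1 - 1 / ((D : ℝ) + 1)) ^ n ≤ ‖circuitOp c 0 0‖ ^ 2 := by
  have h := lovasz_local_lemma (m := zeroProb (circuitOp c)) (x := 1 / ((D : ℝ) + 1))
    (N := fun i => lightcone (c ++ inverse c) {i}) (D := D) (by positivity)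
    ((div_le_one (by positivity)).2 (by linarith [(Nat.cast_nonneg D : (0 : ℝ) ≤ D)]))
    (zeroProb_nonneg _) (zeroProb_empty (circuitOp_mem c))
    (fun i S T hST => zeroProb_sub_insert_le _ i hST)
    (fun i => subset_lightcone _ _ (Finset.mem_singleton_self i)) hcard
    (fun i T hT => zeroProb_insert_of_disjoint c (disjoint_lightcone_of_forall fun j hj => by
      by_contra hd
      exact Finset.disjoint_left.1 hT (mem_lightcone_append_inverse hd) hj))
    (fun i => (hp i).trans (one_div_exp_mul_le hD)) Finset.univ
  rwa [zeroProb_univ, Finset.card_univ, Fintype.card_fin] at h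

end NoErrorProbability

/-! ### Code states prepared by shallow circuits -/

section Codes

variable {n : ℕ} {G : SimpleGraph (Fin n)}

theorem prepared_apply (c : Circuit G) (x : Bits (Fin n)) : prepared c x = circuitOp c x 0 := by
  rw [prepared, Matrix.ofLp_toEuclideanCLM]
  exact (congrFun (mulVec_single_one _ _) x)

theorem prepared_ofLp (c : Circuit G) : (prepared c).ofLp = circuitOp c *ᵥ Pi.single 0 1 := by
  rw [prepared, Matrix.ofLp_toEuclideanCLM]; rfl

theorem inner_prepared (c c' : Circuit G) :
    inner ℂ (prepared c') (prepared c) = ((circuitOp c')ᴴ * circuitOp c) 0 0 := by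
  rw [EuclideanSpace.inner_eq_star_dotProduct, Matrix.mul_apply]
  refine Finset.sum_congr rfl fun x _ => ?_
  rw [prepared_apply, Pi.star_apply, prepared_apply, conjTranspose_apply, mul_comm]

theorem norm_prepared (c : Circuit G) : ‖prepared c‖ = 1 := by
  have h := inner_prepared c c
  have h1 : (circuitOp c)ᴴ * circuitOp c = 1 := mem_unitaryGroup_iff'.1 (circuitOp_mem c)
  rw [h1, one_apply_eq] at h
  rw [← pow_left_inj₀ (norm_nonneg _) zero_le_one two_ne_zero, ← inner_self_eq_norm_sq (𝕜 := ℂ),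
    h]
  simp

theorem trace_mul_pureState_prepared (A : Op (Fin n)) (c : Circuit G) :
    (A * pureState (prepared c)).trace = ((circuitOp c)ᴴ * A * circuitOp c) 0 0 := by
  rw [trace_mul_pureState, prepared_ofLp, star_mulVec, mulVec_mulVec, dotProduct_mulVec,
    vecMul_vecMul, ← dotProduct_mulVec, Matrix.mul_assoc]
  simp

theorem inner_ne_zero_of_no_qubits {φ ψ : Qubits 0} (hφ : ‖φ‖ = 1) (hψ : ‖ψ‖ = 1) :
    inner ℂ φ ψ ≠ 0 := by
  have key : ∀ {φ : Qubits 0}, ‖φ‖ = 1 → φ 0 ≠ 0 := by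
    intro φ hφ h
    have h0 : φ = 0 := by
      ext x
      rw [Subsingleton.elim x 0, h]; rfl
    simp [h0] at hφ
  rw [EuclideanSpace.inner_eq_star_dotProduct, dotProduct, Fintype.sum_subsingleton _ 0]
  exact mul_ne_zero (key hψ) (star_ne_zero.2 (key hφ))

theorem exists_circuit_of_approxComplexity_le {δ : ℝ} {ψ : Qubits n} {t : ℕ}
    (h : approxComplexity G δ ψ ≤ t) : ∃ c : Circuit G, c.length ≤ t ∧
      traceNorm (pureState (prepared c) - pureState ψ) ≤ δ := by
  by_contra! hc
  have h1 : ((t + 1 : ℕ) : ℕ∞) ≤ approxComplexity G δ ψ := by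
    refine le_iInf₂ fun c hcd => ?_
    have : t < c.length := by
      by_contra! hle
      exact absurd hcd (not_le.2 (hc c hle))
    exact_mod_cast this
  have := h1.trans h
  norm_cast at this
  omega

theorem trace_maxMixed {C : Submodule ℂ (Qubits n)} (hC : C ≠ ⊥) : (maxMixed C).trace = 1 := by
  have h0 : (Module.finrank ℂ C : ℂ) ≠ 0 := by
    exact_mod_cast (Nat.pos_of_ne_zero fun h => hC (Submodule.finrank_eq_zero.1 h)).ne'
  have h1 : ((toEuclideanCLM (𝕜 := ℂ)).symm C.starProjection).trace = (Module.finrank ℂ C : ℂ) := by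
    have hp : LinearMap.IsProj C (C.starProjection : Qubits n →ₗ[ℂ] Qubits n) :=
      ⟨fun x => Submodule.starProjection_apply_mem _ _,
        fun x hx => Submodule.starProjection_eq_self_iff.2 hx⟩
    rw [← hp.trace, LinearMap.trace_eq_sum_inner _ (EuclideanSpace.basisFun _ ℂ)]
    refine Finset.sum_congr rfl fun x _ => ?_
    have hA : toEuclideanCLM (𝕜 := ℂ) ((toEuclideanCLM (𝕜 := ℂ)).symm C.starProjection) =
        C.starProjection := StarAlgEquiv.apply_symm_apply _ _
    generalize (toEuclideanCLM (𝕜 := ℂ)).symm C.starProjection = A at hA ⊢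
    rw [← hA, ContinuousLinearMap.coe_coe, EuclideanSpace.basisFun_apply,
      EuclideanSpace.inner_single_left, ofLp_toEuclideanCLM]
    simp
  rw [maxMixed, trace_smul, h1, smul_eq_mul, inv_mul_cancel₀ h0]

theorem bddAbove_subsystemVariance (C : Submodule ℂ (Qubits n)) (d : ℕ) :
    BddAbove {x : ℝ | ∃ ψ ∈ C, ‖ψ‖ = 1 ∧ ∃ R : Finset (Fin n), R.card ≤ d ∧
      x = traceNorm (reduced R (pureState ψ) - reduced R (maxMixed C))} := by
  let b : Finset (Fin n) → ℝ := fun R => Fintype.card (Bits R) + ∑ i, ∑ j,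
    (Fintype.card (Bits {i // i ∉ R}) + ‖reduced R (maxMixed C) j i‖) ^ 2
  have hb : BddAbove (Set.range b) := Set.Finite.bddAbove (Set.finite_range b)
  obtain ⟨M, hM⟩ := hb
  refine ⟨M, ?_⟩
  rintro _ ⟨ψ, _, hψ, R, _, rfl⟩
  refine (traceNorm_le_card_add_sum _).trans (le_trans ?_ (hM ⟨R, rfl⟩))
  have h1 : ∀ x, ‖ψ x‖ ≤ 1 := fun x => hψ ▸ PiLp.norm_apply_le ψ x
  refine add_le_add le_rfl (Finset.sum_le_sum fun i _ => Finset.sum_le_sum fun j _ => ?_)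
  refine pow_le_pow_left₀ (norm_nonneg _) ((norm_sub_le _ _).trans (add_le_add ?_ le_rfl)) 2
  refine (norm_sum_le _ _).trans ?_
  rw [Fintype.card_eq_sum_ones]
  push_cast
  refine Finset.sum_le_sum fun c _ => ?_
  rw [pureState, of_apply, norm_mul, norm_star]
  exact mul_le_one₀ (h1 _) (norm_nonneg _) (h1 _)

theorem traceNorm_le_subsystemVariance {C : Submodule ℂ (Qubits n)} {ψ : Qubits n} (hψ : ψ ∈ C)
    (hnorm : ‖ψ‖ = 1) {R : Finset (Fin n)} {d : ℕ} (hR : R.card ≤ d) :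
    traceNorm (reduced R (pureState ψ) - reduced R (maxMixed C)) ≤ subsystemVariance C d :=
  le_csSup (bddAbove_subsystemVariance C d) ⟨ψ, hψ, hnorm, R, hR, rfl⟩

/-- States near two code states are hard to tell apart on few qubits: `φ₁`, `ψ₁`, the maximally
mixed state, `ψ₂`, `φ₂` are successively close. -/
theorem SupportedOn.norm_trace_proj_le_of_near_code {C : Submodule ℂ (Qubits n)}
    {ψ₁ ψ₂ φ₁ φ₂ : Qubits n} (hψ₁ : ψ₁ ∈ C) (hψ₂ : ψ₂ ∈ C) (h₁ : ‖ψ₁‖ = 1) (h₂ : ‖ψ₂‖ = 1)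
    (hφ₁ : ‖φ₁‖ = 1) (hφ₂ : ‖φ₂‖ = 1) {δ : ℝ}
    (hδ₁ : traceNorm (pureState φ₁ - pureState ψ₁) ≤ δ)
    (hδ₂ : traceNorm (pureState φ₂ - pureState ψ₂) ≤ δ)
    {R : Finset (Fin n)} {d : ℕ} (hR : R.card ≤ d) {P : Op (Fin n)}
    (hS : SupportedOn R P) (hP : P.IsHermitian) (hPP : P * P = P) :
    ‖(P * (pureState φ₂ - pureState φ₁)).trace‖ ≤ subsystemVariance C d + δ := by
  have hC : C ≠ ⊥ := by
    rintro rfl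
    rw [Submodule.mem_bot] at hψ₁
    simp [hψ₁] at h₁
  have e₁ := norm_trace_proj_mul_le hP hPP (X := pureState φ₁ - pureState ψ₁)
    (by rw [trace_sub, trace_pureState hφ₁, trace_pureState h₁, sub_self])
  have e₂ := norm_trace_proj_mul_le hP hPP (X := pureState φ₂ - pureState ψ₂)
    (by rw [trace_sub, trace_pureState hφ₂, trace_pureState h₂, sub_self])
  have e₃ := hS.norm_trace_proj_mul_sub_le hP hPP
    ((trace_pureState h₁).trans (trace_maxMixed hC).symm)
  have e₄ := hS.norm_trace_proj_mul_sub_le hP hPP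
    ((trace_pureState h₂).trans (trace_maxMixed hC).symm)
  have v₁ := traceNorm_le_subsystemVariance hψ₁ h₁ hR
  have v₂ := traceNorm_le_subsystemVariance hψ₂ h₂ hR
  have hsum : (P * (pureState φ₂ - pureState φ₁)).trace =
      (P * (pureState φ₂ - pureState ψ₂)).trace + (P * (pureState ψ₂ - maxMixed C)).trace -
        ((P * (pureState φ₁ - pureState ψ₁)).trace + (P * (pureState ψ₁ - maxMixed C)).trace) := by
    simp only [Matrix.mul_sub, trace_sub]; ring
  rw [hsum]
  have n₁ := norm_add_le (P * (pureState φ₁ - pureState ψ₁)).trace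
    (P * (pureState ψ₁ - maxMixed C)).trace
  have n₂ := norm_add_le (P * (pureState φ₂ - pureState ψ₂)).trace
    (P * (pureState ψ₂ - maxMixed C)).trace
  refine (norm_sub_le _ _).trans ?_
  linarith

/-- The projection onto the states in which the qubit `i` is `1`, conjugated by `c₁`, annihilates
the state prepared by `c₁`. Its expectation in the state prepared by `c₂` is the probability to find
qubit `i` in the state `1` after undoing `c₁`. -/
theorem one_sub_zeroProb_eq_trace (c₁ c₂ : Circuit G) (i : Fin n) :
    ((1 - zeroProb (circuitOp (c₁ ++ inverse c₂)) {i} : ℝ) : ℂ) =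
      (circuitOp c₁ * diagonal (fun x : Bits (Fin n) => if x i = 0 then (0 : ℂ) else 1) *
        (circuitOp c₁)ᴴ *
        (pureState (prepared c₂) - pureState (prepared c₁))).trace := by
  have h1 : (circuitOp c₁)ᴴ * circuitOp c₁ = 1 := mem_unitaryGroup_iff'.1 (circuitOp_mem c₁)
  set d : Bits (Fin n) → ℂ := fun x => if x i = 0 then 0 else 1 with hd
  have hd0 : d 0 = 0 := if_pos rfl
  have h2 : (circuitOp c₁)ᴴ * (circuitOp c₁ * diagonal d * (circuitOp c₁)ᴴ) * circuitOp c₁ =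
      diagonal d := by
    calc _ = ((circuitOp c₁)ᴴ * circuitOp c₁) * diagonal d * ((circuitOp c₁)ᴴ * circuitOp c₁) := by
          simp only [Matrix.mul_assoc]
      _ = _ := by rw [h1, Matrix.one_mul, Matrix.mul_one]
  have h3 : (circuitOp c₂)ᴴ * (circuitOp c₁ * diagonal d * (circuitOp c₁)ᴴ) * circuitOp c₂ =
      circuitOp (c₁ ++ inverse c₂) * diagonal d * (circuitOp (c₁ ++ inverse c₂))ᴴ := by
    rw [circuitOp_append, circuitOp_inverse, conjTranspose_mul, conjTranspose_conjTranspose]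
    simp only [Matrix.mul_assoc]
  rw [Matrix.mul_sub, trace_sub, trace_mul_pureState_prepared, trace_mul_pureState_prepared, h2,
    h3, diagonal_apply_eq, hd0, sub_zero, conj_diagonal_apply,
    ← zeroProb_empty (circuitOp_mem (c₁ ++ inverse c₂)), zeroProb, zeroProb,
    ← Finset.sum_sub_distrib]
  push_cast
  refine Finset.sum_congr rfl fun x _ => ?_
  by_cases hx : x i = 0 <;> simp [hd, hx]

end Codes
end SRECode

theorem mainTheorem3 (n : ℕ) (G : SimpleGraph (Fin n)) (f : ℕ → ℕ)
    (hf : SRECode.IsLightconeFunction G f)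
    (k : ℝ) (C : Submodule ℂ (SRECode.Qubits n)) (hC : (Module.finrank ℂ C : ℝ) = 2 ^ k)
    (ψ₁ ψ₂ : SRECode.Qubits n) (hψ₁ : ψ₁ ∈ C) (hψ₂ : ψ₂ ∈ C)
    (hnorm₁ : ‖ψ₁‖ = 1) (hnorm₂ : ‖ψ₂‖ = 1) (horth : inner ℂ ψ₁ ψ₂ = 0)
    (t : ℕ) (δ : ℝ)
    (ht₁ : SRECode.approxComplexity G δ ψ₁ ≤ t) (ht₂ : SRECode.approxComplexity G δ ψ₂ ≤ t)
    (hδ : δ ≤ (1 - 1 / (f (4 * t) : ℝ)) ^ ((n : ℝ) / 2)) :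
    SRECode.subsystemVariance C (f t) > 1 / (Real.exp 1 * (f (4 * t) : ℝ)) - δ := by
  open SRECode Matrix in
  by_contra! hε
  obtain ⟨c₁, hc₁, hd₁⟩ := exists_circuit_of_approxComplexity_le ht₁
  obtain ⟨c₂, hc₂, hd₂⟩ := exists_circuit_of_approxComplexity_le ht₂
  -- Without qubits the Hilbert space is a line and has no two orthogonal unit vectors.
  have hn : n ≠ 0 := by
    rintro rfl
    exact inner_ne_zero_of_no_qubits hnorm₁ hnorm₂ horth
  have hlen : (c₁ ++ inverse c₂).length ≤ 2 * t := by
    rw [List.length_append, length_inverse]; omega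
  have hcard : ∀ i, (lightcone ((c₁ ++ inverse c₂) ++ inverse (c₁ ++ inverse c₂)) {i}).card ≤
      f (4 * t) := fun i => card_lightcone_le hf
        (by rw [List.length_append, length_inverse (c₁ ++ inverse c₂)]; omega) i
  have hD : 0 < f (4 * t) := by
    have i : Fin n := ⟨0, Nat.pos_of_ne_zero hn⟩
    exact (Finset.card_pos.2 ⟨i, subset_lightcone _ _ (Finset.mem_singleton_self i)⟩).trans_le
      (hcard i)
  have hp : ∀ i, 1 - zeroProb (circuitOp (c₁ ++ inverse c₂)) {i} ≤
      1 / (Real.exp 1 * (f (4 * t) : ℝ)) := by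
    intro i
    have hU : (circuitOp c₁)ᴴ * circuitOp c₁ = 1 := mem_unitaryGroup_iff'.1 (circuitOp_mem c₁)
    have hS := (supportedOn_diagonal (S := {i})
      (d := fun x : Bits (Fin n) => if x i = 0 then (0 : ℂ) else 1) fun x y hxy => by
        rw [hxy i (Finset.mem_singleton_self i)]).circuit_conj c₁
    have h1 := hS.norm_trace_proj_le_of_near_code hψ₁ hψ₂ hnorm₁ hnorm₂ (norm_prepared c₁)
      (norm_prepared c₂) hd₁ hd₂ (card_lightcone_le hf hc₁ i)
      (isHermitian_mul_mul_conjTranspose _ (isHermitian_diagonal_of_self_adjoint _ (by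
        funext x; by_cases hx : x i = 0 <;> simp [hx])))
      (by
        calc _ = circuitOp c₁ * (diagonal (fun x : Bits (Fin n) => if x i = 0 then (0 : ℂ) else 1) *
              ((circuitOp c₁)ᴴ * circuitOp c₁) *
              diagonal (fun x : Bits (Fin n) => if x i = 0 then (0 : ℂ) else 1)) * (circuitOp c₁)ᴴ := by
              simp only [Matrix.mul_assoc]
          _ = _ := by
            rw [hU, Matrix.mul_one, diagonal_mul_diagonal]
            congr 3
            funext x
            split_ifs <;> simp)
    rw [← one_sub_zeroProb_eq_trace, Complex.norm_real] at h1
    exact (le_abs_self _).trans (h1.trans (by linarith))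
  -- The two estimates of the overlap of the prepared states.
  have hlow := pow_le_zeroProb_univ _ hD hcard hp
  have hup := norm_inner_le_of_traceNorm_le (norm_prepared c₂) (norm_prepared c₁) hnorm₂ hnorm₁
    (by rw [← inner_conj_symm, horth, map_zero]) hd₂ hd₁
  rw [inner_prepared, ← circuitOp_inverse, ← circuitOp_append] at hup
  have hD₁ : (1 : ℝ) ≤ f (4 * t) := by exact_mod_cast hD
  have hb₀ : 0 ≤ 1 - 1 / (f (4 * t) : ℝ) :=
    sub_nonneg.2 ((div_le_one (by linarith)).2 hD₁)
  have hlt : (1 - 1 / (f (4 * t) : ℝ)) ^ n < (1 - 1 / ((f (4 * t) : ℝ) + 1)) ^ n := by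
    refine pow_lt_pow_left₀ (sub_lt_sub_left ?_ _) hb₀ hn
    exact one_div_lt_one_div_of_lt (by linarith) (by linarith)
  have hsq : ((1 - 1 / (f (4 * t) : ℝ)) ^ ((n : ℝ) / 2)) ^ 2 =
      (1 - 1 / (f (4 * t) : ℝ)) ^ n := by
    rw [← Real.rpow_natCast, ← Real.rpow_mul hb₀, ← Real.rpow_natCast]
    congr 1
    push_cast
    ring
  have := pow_le_pow_left₀ (norm_nonneg _) (hup.trans hδ) 2
  linarith
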